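/- Let $V$ be a closed isometric linear operator in a complex Hilbert space $H$, with domain $D(V)\subseteq H$ (not necessarily dense) and range in $H$, and let $E$ be the identity operator. Let $\mathbb D=\{|z|<1\}$, $\mathbb D_e=\{|z|>1\}$, $\mathbb T=\{|z|=1\}$. A generalized resolvent of $V$ is an operator-valued function of the form $\mathbf R_z h=P_H(E_{\widetilde H}-zU)^{-1}h$ ($h\in H$, $|z|\ne1$), where $U\supseteq V$ is a unitary operator in a Hilbert space $\widetilde H\supseteq H$ and $P_H$ is the orthogonal projection of $\widetilde H$ onto $H$. For $\zeta\in\mathbb C$ put $M_\zeta=(E-\zeta V)D(V)$ and $N_\zeta=H\ominus M_\zeta$. Fix $z_0\in\mathbb D\setminus\{0\}$ and let $V_{z_0}=(V-\overline{z_0}E)(E-z_0V)^{-1}$, an isometric operator with domain $M_{z_0}$. For a linear contraction $C:N_{z_0}\to N_{1/\overline{z_0}}$ put $V^+_{z_0;C}=V_{z_0}\oplus C$ on $H=M_{z_0}\oplus N_{z_0}$ and $$V_{C;z_0}=(V^+_{z_0;C}+\overline{z_0}E)(E+z_0V^+_{z_0;C})^{-1}.$$ Let $\mathbf R_z$ be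 an arbitrary generalized resolvent of $V$, and let $C(\lambda;z_0)$ correspond to it by Inin's formula, that is, let it be an analytic function of $\lambda\in\mathbb D$ whose values are linear contractions from $N_{z_0}$ into $N_{1/\overline{z_0}}$, such that $$\mathbf R_\lambda=\left[E-\lambda V_{C(\lambda;z_0);z_0}\right]^{-1},\qquad \lambda\in\mathbb D.$$ Let $\Delta$ be an open arc of $\mathbb T$. Then $\mathbf R_z$ has an analytic continuation to $\mathbb D\cup\mathbb D_e\cup\Delta$ if and only if the following conditions are satisfied: 1. $C(\lambda;z_0)$ has an extension to $\mathbb D\cup\Delta$ which is continuous in the uniform operator topology; 2. the extended $C(\lambda;z_0)$ maps $N_{z_0}$ isometrically onto the whole of $N_{1/\overline{z_0}}$ for all $\lambda\in\Delta$; 3. the operator $(E-\lambda V_{C(\lambda;z_0);z_0})^{-1}$ exists and is defined on the whole of $H$ for all $\lambda\in\Delta$. -/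

import Mathlib

open Complex Metric Set
open scoped ComplexConjugate

universe u v

noncomputable section

namespace GenRes

variable {H : Type u} [NormedAddCommGroup H] [InnerProductSpace ℂ H]

/-- `V` is a closed isometric operator in `H`; its domain `D(V)` is a linear manifold of `H` that
need not be dense. -/
structure IsClosedIsometric (V : H →ₗ.[ℂ] H) : Prop where
  closed : V.IsClosed
  isometric : ∀ x : V.domain, ‖V x‖ = ‖(x : H)‖

/-- The operator `E - z V`, defined on `D(V)`. -/
def idSub (V : H →ₗ.[ℂ] H) (z : ℂ) : V.domain →ₗ[ℂ] H :=
  V.domain.subtype - z • V.toFun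

/-- `M_z = (E - z V) D(V)`. -/
def M (V : H →ₗ.[ℂ] H) (z : ℂ) : Submodule ℂ H := LinearMap.range (idSub V z)

/-- The defect subspace `N_z = H ⊖ M_z`. -/
def N (V : H →ₗ.[ℂ] H) (z : ℂ) : Submodule ℂ H := (M V z)ᗮ

theorem idSub_apply (V : H →ₗ.[ℂ] H) (z : ℂ) (x : V.domain) :
    idSub V z x = (x : H) - z • V x := rfl

theorem le_norm_idSub {V : H →ₗ.[ℂ] H} (hV : IsClosedIsometric V) (z : ℂ) (x : V.domain) :
    (1 - ‖z‖) * ‖(x : H)‖ ≤ ‖idSub V z x‖ := by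
  have h := norm_sub_norm_le (x : H) (z • V x)
  rw [norm_smul, hV.isometric] at h
  rw [idSub_apply]
  linarith

theorem idSub_injective {V : H →ₗ.[ℂ] H} (hV : IsClosedIsometric V) {z : ℂ} (hz : ‖z‖ < 1) :
    Function.Injective (idSub V z) := by
  rw [← LinearMap.ker_eq_bot, LinearMap.ker_eq_bot']
  intro x hx
  have h := le_norm_idSub hV z x
  rw [hx, norm_zero] at h
  have h0 : ‖(x : H)‖ ≤ 0 := by
    by_contra hne
    push Not at hne
    nlinarith
  exact Subtype.ext (norm_le_zero_iff.mp h0)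

theorem norm_cayley_eq {V : H →ₗ.[ℂ] H} (hV : IsClosedIsometric V) (z : ℂ) (x : V.domain) :
    ‖V x - conj z • (x : H)‖ = ‖idSub V z x‖ := by
  have h1 := @norm_sub_sq ℂ H _ _ _ (V x) (conj z • (x : H))
  have h2 := @norm_sub_sq ℂ H _ _ _ (x : H) (z • V x)
  rw [idSub_apply]
  have h3 : RCLike.re (inner ℂ (V x) (conj z • (x : H)))
      = RCLike.re (inner ℂ (x : H) (z • V x)) := by
    rw [inner_smul_right, inner_smul_right, ← inner_conj_symm (V x) (x : H), ← map_mul,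
      RCLike.conj_re]
  rw [h3, norm_smul, hV.isometric x, RCLike.norm_conj] at h1
  rw [norm_smul, hV.isometric x] at h2
  have h4 : ‖V x - conj z • (x : H)‖ ^ 2 = ‖(x : H) - z • V x‖ ^ 2 := by rw [h1, h2]
  exact (sq_eq_sq₀ (norm_nonneg _) (norm_nonneg _)).mp h4

/-- The inverse `(E - z V)⁻¹ : M_z → D(V)` for `|z| < 1`. -/
def idSubInv {V : H →ₗ.[ℂ] H} (hV : IsClosedIsometric V) {z : ℂ} (hz : ‖z‖ < 1) :
    M V z ≃ₗ[ℂ] V.domain :=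
  (LinearEquiv.ofInjective (idSub V z) (idSub_injective hV hz)).symm

/-- The isometric operator `V_z = (V - z̄ E)(E - z V)⁻¹` with domain `M_z`, for `|z| < 1`. -/
def Vz {V : H →ₗ.[ℂ] H} (hV : IsClosedIsometric V) {z : ℂ} (hz : ‖z‖ < 1) : M V z →ₗᵢ[ℂ] H where
  toLinearMap := (V.toFun - conj z • V.domain.subtype) ∘ₗ (idSubInv hV hz).toLinearMap
  norm_map' := by
    intro y
    obtain ⟨x, rfl⟩ := (idSubInv hV hz).symm.surjective y
    have h : (((idSubInv hV hz).symm x : M V z) : H) = idSub V z x := rfl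
    rw [← Submodule.norm_coe, h]
    simpa using norm_cayley_eq hV z x

variable [CompleteSpace H]

theorem isClosed_M {V : H →ₗ.[ℂ] H} (hV : IsClosedIsometric V) {z : ℂ} (hz : ‖z‖ < 1) :
    IsClosed (M V z : Set H) := by
  have hg : IsClosed (V.graph : Set (H × H)) := hV.closed
  have : CompleteSpace V.graph := hg.completeSpace_coe
  let f : V.graph →L[ℂ] H := ((ContinuousLinearMap.fst ℂ H H) -
    z • (ContinuousLinearMap.snd ℂ H H)).comp V.graph.subtypeL
  have hf : ∀ p : V.graph, ∃ x : V.domain, (p : H × H) = ((x : H), V x) := by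
    intro p
    obtain ⟨x, hx1, hx2⟩ := (LinearPMap.mem_graph_iff V).mp p.2
    exact ⟨x, Prod.ext hx1.symm hx2.symm⟩
  have hanti : AntilipschitzWith (Real.toNNReal (1 - ‖z‖)⁻¹) f := by
    apply ContinuousLinearMap.antilipschitz_of_bound
    intro p
    obtain ⟨x, hx⟩ := hf p
    have h := le_norm_idSub hV z x
    have hfx : f p = idSub V z x := by
      simp [f, hx, idSub_apply]
    have hp : ‖p‖ = ‖(x : H)‖ := by
      rw [← Submodule.norm_coe, hx, Prod.norm_def]
      simp [hV.isometric x]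
    have hpos : 0 < 1 - ‖z‖ := by linarith
    rw [hfx, hp, Real.coe_toNNReal _ (inv_nonneg.mpr hpos.le), inv_mul_eq_div, le_div_iff₀ hpos]
    linarith
  have hr : (M V z : Set H) = Set.range f := by
    ext y
    constructor
    · rintro ⟨x, rfl⟩
      exact ⟨⟨((x : H), V x), V.mem_graph x⟩, by simp [f, idSub_apply]⟩
    · rintro ⟨p, rfl⟩
      obtain ⟨x, hx⟩ := hf p
      exact ⟨x, by simp [f, hx, idSub_apply]⟩
  rw [hr]
  exact hanti.isClosed_range f.uniformContinuous

theorem hasOrthogonalProjection_M {V : H →ₗ.[ℂ] H} (hV : IsClosedIsometric V) {z : ℂ}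
    (hz : ‖z‖ < 1) : (M V z).HasOrthogonalProjection := by
  have := (isClosed_M hV hz).completeSpace_coe
  infer_instance

instance (V : H →ₗ.[ℂ] H) (z : ℂ) : (N V z).HasOrthogonalProjection :=
  inferInstanceAs ((M V z)ᗮ).HasOrthogonalProjection

/-- The orthogonal sum `V⁺_{z;C} = V_z ⊕ C`, acting on the whole of `H = M_z ⊕ N_z`, where
`C : N_z → N_{1/z̄}` is a bounded operator and `0 < |z| < 1`. -/
def Vplus {V : H →ₗ.[ℂ] H} (hV : IsClosedIsometric V) {z : ℂ} (hz : ‖z‖ < 1)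
    (C : N V z →L[ℂ] N V (conj z)⁻¹) : H →L[ℂ] H :=
  haveI := hasOrthogonalProjection_M hV hz
  (Vz hV hz).toContinuousLinearMap ∘L (M V z).orthogonalProjectionOnto
    + (N V (conj z)⁻¹).subtypeL ∘L C ∘L (N V z).orthogonalProjectionOnto

/-- The orthogonal extension `V_{C;z} = (V⁺_{z;C} + z̄ E)(E + z V⁺_{z;C})⁻¹` of `V` defined by `C`.
The inverse exists as a bounded operator on `H` whenever `C` is a contraction. -/
def VC {V : H →ₗ.[ℂ] H} (hV : IsClosedIsometric V) {z : ℂ} (hz : ‖z‖ < 1)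
    (C : N V z →L[ℂ] N V (conj z)⁻¹) : H →L[ℂ] H :=
  (Vplus hV hz C + conj z • (1 : H →L[ℂ] H)) * Ring.inverse (1 + z • Vplus hV hz C)

/-- The class `𝒮(H₁; H₂)`: operator-valued functions analytic in the open unit disc whose values
are linear contractions from `H₁` into `H₂`. Values outside the disc are irrelevant. -/
structure IsSchur (H₁ H₂ : Submodule ℂ H) (F : ℂ → (H₁ →L[ℂ] H₂)) : Prop where
  analytic : AnalyticOnNhd ℂ F (ball 0 1)
  contraction : ∀ ζ ∈ ball (0 : ℂ) 1, ‖F ζ‖ ≤ 1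

/-- `R` is a generalized resolvent of `V`: there are a Hilbert space `K ⊇ H` (with embedding `ι`)
and a unitary operator `U ⊇ V` in `K` with `R_ζ h = P (E - ζ U)⁻¹ h` for `h ∈ H` and `|ζ| ≠ 1`.
The orthogonal projection of `K` onto `H` is the adjoint of the embedding. Values of `R` on the
unit circle are irrelevant. -/
def IsGeneralizedResolvent (V : H →ₗ.[ℂ] H) (R : ℂ → (H →L[ℂ] H)) : Prop :=
  ∃ (K : Type v) (_ : NormedAddCommGroup K) (_ : InnerProductSpace ℂ K) (_ : CompleteSpace K)
    (ι : H →ₗᵢ[ℂ] K) (U : K →L[ℂ] K),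
    U ∈ unitary (K →L[ℂ] K) ∧
    (∀ x : V.domain, U (ι x) = ι (V x)) ∧
    ∀ ζ : ℂ, ‖ζ‖ ≠ 1 →
      R ζ = (ContinuousLinearMap.adjoint ι.toContinuousLinearMap) ∘L
        (Ring.inverse (1 - ζ • U)) ∘L ι.toContinuousLinearMap

/-- `C ∈ 𝒮(N_z; N_{1/z̄})` corresponds to `R` by Inin's formula: `R_ζ` is the two-sided inverse of
`E - ζ V_{C(ζ);z}` for all `|ζ| < 1`. -/
structure IninCorresponds {V : H →ₗ.[ℂ] H} (hV : IsClosedIsometric V) {z : ℂ} (hz : ‖z‖ < 1)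
    (R : ℂ → (H →L[ℂ] H)) (C : ℂ → (N V z →L[ℂ] N V (conj z)⁻¹)) : Prop where
  schur : IsSchur (N V z) (N V (conj z)⁻¹) C
  right_inv : ∀ ζ ∈ ball (0 : ℂ) 1, (1 - ζ • VC hV hz (C ζ)) * R ζ = 1
  left_inv : ∀ ζ ∈ ball (0 : ℂ) 1, R ζ * (1 - ζ • VC hV hz (C ζ)) = 1

/-- `Δ` is a (non-empty) open arc of the unit circle; the whole circle is allowed. -/
def IsOpenArc (Δ : Set ℂ) : Prop :=
  ∃ a b : ℝ, a < b ∧ Δ = (fun θ : ℝ => Complex.exp (θ * I)) '' Ioo a b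

/-- `R`, given for `|z| ≠ 1`, has an analytic continuation (in the operator norm) to
`𝔻 ∪ 𝔻_e ∪ Δ`. -/
def HasAnalyticContinuation (R : ℂ → (H →L[ℂ] H)) (Δ : Set ℂ) : Prop :=
  ∃ T : ℂ → (H →L[ℂ] H),
    AnalyticOnNhd ℂ T ({z | ‖z‖ < 1} ∪ {z | 1 < ‖z‖} ∪ Δ) ∧ ∀ z : ℂ, ‖z‖ ≠ 1 → T z = R z

end GenRes

end

namespace GenRes

open Filter Topology

/-! ### Removability of an arc for continuous functions -/

section Painleve

variable {E : Type*} [NormedAddCommGroup E] [NormedSpace ℂ E]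

/-! Write W for V⁺_{z;C(ζ)}. Inin's formula T = (1 - ζ(W + z̄)(1 + zW)⁻¹)⁻¹ is a fractional linear
relation with inverse W = ((1 - ζz̄)T - 1)((ζ - z)T + z)⁻¹ (`resolventDen_and_ofResolvent`), so
regularity passes between the resolvent and C wherever the denominators are invertible. The two
sides of the circle are linked by the symmetry R_ζ* + R_{1/ζ̄} = E
(`IsGeneralizedResolvent.star_add`), inherited from the unitary dilation; the map ζ ↦ 1/ζ̄ fixes
exactly the circle.

If R continues to T, the symmetry becomes T* + T = E on Δ. Then the spectrum of T lies on Re = 1/2,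
the denominator (ζ - z)T + z is invertible, and W is unitary (`isUnit_resolventDen`,
`ofResolvent_mem_unitary`). As a limit from the disc, W still extends V_z, so it carries N_z onto
N_{1/z̄}; its compression to these subspaces is the boundary value of C.

Conversely, the conditions make (E - ζV_C)⁻¹ continuous on 𝔻 ∪ Δ, with G* + G = E on Δ because V_C
is isometric there. The symmetry transports this continuity to the exterior with the same boundary
values, so the glued function is continuous across Δ, and Painlevé's theorem makes it analytic. -/

theorem integral_boundary_rect_eq_zero_of_zero_notMem {f : ℂ → E} {U : Set ℂ}
    (hc : ContinuousOn f U) (hd : ∀ w ∈ U, w.im ≠ 0 → DifferentiableAt ℂ f w) {z w : ℂ}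
    (hzw : uIcc z.re w.re ×ℂ uIcc z.im w.im ⊆ U)
    (h0 : (0 : ℝ) ∉ Ioo (min z.im w.im) (max z.im w.im)) :
    (∫ x : ℝ in z.re..w.re, f (x + z.im * I)) - (∫ x : ℝ in z.re..w.re, f (x + w.im * I)) +
      I • (∫ y : ℝ in z.im..w.im, f (w.re + y * I)) -
      I • (∫ y : ℝ in z.im..w.im, f (z.re + y * I)) = 0 := by
  refine integral_boundary_rect_eq_zero_of_continuousOn_of_differentiableOn f z w
    (hc.mono hzw) fun p hp => ?_
  rw [mem_reProdIm] at hp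
  refine (hd p (hzw ?_) fun h => h0 (h ▸ hp.2)).differentiableWithinAt
  exact mem_reProdIm.mpr ⟨Ioo_subset_Icc_self hp.1, Ioo_subset_Icc_self hp.2⟩

/-- **Painlevé's theorem** for a segment of the real line: a continuous function that is holomorphic
off the real line is holomorphic. -/
theorem differentiableOn_of_continuousOn_of_differentiableAt_off_real [CompleteSpace E]
    {f : ℂ → E} {U : Set ℂ} (hU : IsOpen U) (hc : ContinuousOn f U)
    (hd : ∀ w ∈ U, w.im ≠ 0 → DifferentiableAt ℂ f w) : DifferentiableOn ℂ f U := by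
  -- Morera: only rectangle integrals matter. A rectangle crossing the real axis is cut along it
  -- into two whose interiors avoid it.
  refine (isConservativeOn_and_continuousOn_iff_isDifferentiableOn hU).mp ⟨fun z w hzw => ?_, hc⟩
  rw [← add_eq_zero_iff_eq_neg, wedgeIntegral_add_wedgeIntegral_eq]
  by_cases h0 : (0 : ℝ) ∈ Ioo (min z.im w.im) (max z.im w.im)
  swap
  · exact integral_boundary_rect_eq_zero_of_zero_notMem hc hd hzw h0
  have h0' : (0 : ℝ) ∈ uIcc z.im w.im := Ioo_subset_Icc_self h0
  have h1 := integral_boundary_rect_eq_zero_of_zero_notMem hc hd (z := z) (w := (w.re : ℂ))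
    ((reProdIm_subset_iff'.mpr (Or.inl ⟨by simp, by
      simpa using uIcc_subset_uIcc left_mem_uIcc h0'⟩)).trans hzw) (by
        simp only [ofReal_im, mem_Ioo]
        rintro ⟨h2, h3⟩
        rcases le_total z.im 0 with h | h
        · rw [max_eq_right h] at h3; exact lt_irrefl _ h3
        · rw [min_eq_right h] at h2; exact lt_irrefl _ h2)
  have h2 := integral_boundary_rect_eq_zero_of_zero_notMem hc hd (z := (z.re : ℂ)) (w := w)
    ((reProdIm_subset_iff'.mpr (Or.inl ⟨by simp, by
      simpa using uIcc_subset_uIcc h0' right_mem_uIcc⟩)).trans hzw) (by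
        simp only [ofReal_im, mem_Ioo]
        rintro ⟨h2, h3⟩
        rcases le_total w.im 0 with h | h
        · rw [max_eq_left h] at h3; exact lt_irrefl _ h3
        · rw [min_eq_left h] at h2; exact lt_irrefl _ h2)
  have hint : ∀ x ∈ uIcc z.re w.re, ∀ a ∈ uIcc z.im w.im, ∀ b ∈ uIcc z.im w.im,
      IntervalIntegrable (fun y : ℝ => f ((x : ℝ) + y * I)) MeasureTheory.volume a b := by
    intro x hx a ha b hb
    refine ContinuousOn.intervalIntegrable (hc.comp (by fun_prop) fun y hy => hzw ?_)
    exact mem_reProdIm.mpr ⟨by simpa using hx, by simpa using uIcc_subset_uIcc ha hb hy⟩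
  simp only [ofReal_re, ofReal_im, ofReal_zero] at h1 h2
  rw [← intervalIntegral.integral_add_adjacent_intervals
      (hint _ right_mem_uIcc _ left_mem_uIcc _ h0') (hint _ right_mem_uIcc _ h0' _ right_mem_uIcc),
    ← intervalIntegral.integral_add_adjacent_intervals
      (hint _ left_mem_uIcc _ left_mem_uIcc _ h0') (hint _ left_mem_uIcc _ h0' _ right_mem_uIcc),
    ← add_zero (0 : E)]
  -- The zero on the right is replaced by the sum of the two vanishing integrals; their common side
  -- on the real axis cancels.
  nth_rewrite 1 [← h1]
  rw [← h2]
  simp only [smul_add]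
  abel

/-- A function that is continuous across an arc of the unit circle and holomorphic off it is
analytic at the points of the arc. -/
theorem analyticAt_exp_of_continuousOn_of_differentiableAt [CompleteSpace E] {f : ℂ → E}
    {a b θ : ℝ} (hθ : θ ∈ Ioo a b) (hc : ∀ t ∈ Ioo a b, ContinuousAt f (exp (t * I)))
    (hd : ∀ w, ‖w‖ ≠ 1 → DifferentiableAt ℂ f w) : AnalyticAt ℂ f (exp (θ * I)) := by
  have hU : IsOpen {w : ℂ | w.re ∈ Ioo a b} := isOpen_Ioo.preimage continuous_re
  have hd' : ∀ w ∈ {w : ℂ | w.re ∈ Ioo a b}, w.im ≠ 0 →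
      DifferentiableAt ℂ (fun w => f (exp (w * I))) w := by
    intro w _ hw
    refine DifferentiableAt.comp w (hd (exp (w * I)) ?_) (by fun_prop)
    -- The modulus of exp(iw) is exp(-Im w), so this map straightens the circle to the real axis.
    rw [norm_exp, Ne, Real.exp_eq_one_iff]
    simpa using hw
  have hdiff := differentiableOn_of_continuousOn_of_differentiableAt_off_real hU
    (f := fun w => f (exp (w * I))) (fun w hw => by
      by_cases h : w.im = 0
      · have : w = (w.re : ℂ) := Complex.ext rfl (by simpa using h)
        rw [this]
        exact (ContinuousAt.comp (f := fun w : ℂ => exp (w * I)) (hc w.re hw)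
          (by fun_prop)).continuousWithinAt
      · exact (hd' w hw h).continuousAt.continuousWithinAt) hd'
  have han : AnalyticAt ℂ (fun w => f (exp (w * I))) (θ : ℂ) :=
    hdiff.analyticAt (hU.mem_nhds (by simpa using hθ))
  have hne : exp (θ * I) ≠ 0 := exp_ne_zero _
  -- A local inverse of w ↦ exp(iw); dividing by exp(iθ) moves the argument of the logarithm to 1,
  -- away from the cut.
  have hlog : AnalyticAt ℂ (fun ζ : ℂ => (θ : ℂ) - I * log (ζ / exp (θ * I))) (exp (θ * I)) := by
    refine analyticAt_const.sub (analyticAt_const.mul (AnalyticAt.clog ?_ ?_))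
    · exact analyticAt_id.div analyticAt_const hne
    · simp [hne]
  have hcomp : AnalyticAt ℂ ((fun w => f (exp (w * I))) ∘
      fun ζ : ℂ => (θ : ℂ) - I * log (ζ / exp (θ * I))) (exp (θ * I)) :=
    AnalyticAt.comp (by simpa [hne] using han) hlog
  refine hcomp.congr ?_
  filter_upwards [isOpen_ne.mem_nhds hne] with ζ hζ
  simp only [Function.comp]
  have : ((θ : ℂ) - I * log (ζ / exp (θ * I))) * I = θ * I + log (ζ / exp (θ * I)) := by
    linear_combination (-log (ζ / exp (θ * I))) * I_mul_I
  rw [this, exp_add, exp_log (div_ne_zero hζ hne), mul_div_cancel₀ _ hne]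

end Painleve
-- Cayley-type transforms in a C⋆-algebra
section Algebra

variable {A : Type*} [CStarAlgebra A]

theorem star_smul_eq_conj_smul (c : ℂ) (a : A) : star (c • a) = conj c • star a :=
  star_smul c a

theorem isUnit_smul_of_ne_zero {c : ℂ} (hc : c ≠ 0) {a : A} (ha : IsUnit a) : IsUnit (c • a) :=
  ha.smul (Units.mk0 c hc)

/-- T - 1/2 is skew-adjoint, so i(T - 1/2) has real spectrum and the spectrum of T lies on the line
Re = 1/2. -/
theorem isUnit_smul_one_sub_of_star_add_self {T : A} (hT : star T + T = 1) {w : ℂ}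
    (hw : w.re ≠ 1 / 2) : IsUnit (w • (1 : A) - T) := by
  have hS : IsSelfAdjoint (I • (T - (1 / 2 : ℂ) • (1 : A))) := by
    have hT' : star T = 1 - T := eq_sub_of_add_eq hT
    have h2 : conj (2 : ℂ) = 2 := conj_ofNat 2
    simp only [IsSelfAdjoint, star_smul_eq_conj_smul, star_sub, hT', star_one, conj_I,
      map_div₀, map_one, h2]
    module
  have hu : I * (w - 1 / 2) ∉ spectrum ℂ (I • (T - (1 / 2 : ℂ) • (1 : A))) := by
    intro h
    have h1 := congrArg Complex.im (hS.mem_spectrum_eq_re h)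
    simp at h1
    exact hw (by linarith)
  rw [spectrum.notMem_iff, Algebra.algebraMap_eq_smul_one] at hu
  have heq : w • (1 : A) - T = (-I) • ((I * (w - 1 / 2)) • (1 : A) -
      I • (T - (1 / 2 : ℂ) • (1 : A))) := by
    match_scalars <;> ring_nf <;> simp
  rw [heq]
  exact isUnit_smul_of_ne_zero (neg_ne_zero.mpr I_ne_zero) hu

theorem isUnit_one_sub_smul_of_mem_unitary {U : A} (hU : U ∈ unitary A) {ζ : ℂ} (hζ : ‖ζ‖ ≠ 1) :
    IsUnit (1 - ζ • U) := by
  rcases eq_or_ne ζ 0 with rfl | h0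
  · simp
  have h : ζ⁻¹ ∉ spectrum ℂ U := fun h => by
    have := spectrum.subset_circle_of_unitary hU h
    rw [mem_sphere_zero_iff_norm, norm_inv, inv_eq_one] at this
    exact hζ this
  rw [spectrum.notMem_iff, Algebra.algebraMap_eq_smul_one] at h
  have heq : 1 - ζ • U = ζ • (ζ⁻¹ • (1 : A) - U) := by
    rw [smul_sub, smul_smul, mul_inv_cancel₀ h0, one_smul]
  rw [heq]
  exact isUnit_smul_of_ne_zero h0 h

/-- Since U*U = 1, the element L = 1 - ζ̄U* factors as -ζ̄U*(1 - ζ̄⁻¹U). The sum is therefore L⁻¹(1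
- ζ̄U*) = 1. -/
theorem star_inverse_one_sub_smul_add {U : A} (hU : U ∈ unitary A) {ζ : ℂ} (h0 : ζ ≠ 0)
    (hζ : ‖ζ‖ ≠ 1) :
    star (Ring.inverse (1 - ζ • U)) + Ring.inverse (1 - (conj ζ)⁻¹ • U) = 1 := by
  have hc : conj ζ ≠ 0 := (map_ne_zero _).mpr h0
  have hL := isUnit_one_sub_smul_of_mem_unitary hU hζ
  have hM := isUnit_one_sub_smul_of_mem_unitary hU (ζ := (conj ζ)⁻¹)
    (by rwa [norm_inv, RCLike.norm_conj, Ne, inv_eq_one])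
  have h1 : star (1 - ζ • U) = -(conj ζ • star U) * (1 - (conj ζ)⁻¹ • U) := by
    rw [mul_sub, mul_one, neg_mul, smul_mul_smul_comm, mul_inv_cancel₀ hc,
      Unitary.star_mul_self_of_mem hU]
    simp [sub_eq_add_neg, add_comm]
  rw [← Ring.inverse_star]
  set L := star (1 - ζ • U) with hLdef
  set M := 1 - (conj ζ)⁻¹ • U
  have hL' : IsUnit L := hL.star
  have h2 : Ring.inverse M = Ring.inverse L * -(conj ζ • star U) := by
    have h3 : Ring.inverse L * L * Ring.inverse M = Ring.inverse L * -(conj ζ • star U) := by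
      nth_rewrite 2 [h1]
      rw [mul_assoc, mul_assoc, Ring.mul_inverse_cancel M hM, mul_one]
    rwa [Ring.inverse_mul_cancel L hL', one_mul] at h3
  have h4 : 1 + -(conj ζ • star U) = L := by
    simp [hLdef, sub_eq_add_neg]
  rw [h2, ← mul_one_add, h4, Ring.inverse_mul_cancel L hL']

/-- For L = 1 - ζB, the relations B*B = 1 and |ζ| = 1 give L* + L = L*L; multiply by (L*)⁻¹ on the
left and L⁻¹ on the right. -/
theorem star_inverse_add_inverse_one_sub_smul {B : A} (hB : star B * B = 1) {ζ : ℂ} (hζ : ‖ζ‖ = 1)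
    (hL : IsUnit (1 - ζ • B)) :
    star (Ring.inverse (1 - ζ • B)) + Ring.inverse (1 - ζ • B) = 1 := by
  have hζ' : conj ζ * ζ = 1 := by rw [conj_mul', hζ]; simp
  have h1 : star (1 - ζ • B) + (1 - ζ • B) = star (1 - ζ • B) * (1 - ζ • B) := by
    simp only [star_sub, star_one, star_smul_eq_conj_smul, mul_sub, sub_mul, mul_one,
      one_mul, smul_mul_smul_comm, hB, hζ']
    module
  rw [← Ring.inverse_star]
  set L := 1 - ζ • B
  have hL' : IsUnit (star L) := hL.star
  calc Ring.inverse (star L) + Ring.inverse L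
      = Ring.inverse (star L) * (L * Ring.inverse L)
        + Ring.inverse (star L) * star L * Ring.inverse L := by
        rw [Ring.mul_inverse_cancel L hL, Ring.inverse_mul_cancel _ hL', mul_one, one_mul]
    _ = Ring.inverse (star L) * (star L + L) * Ring.inverse L := by noncomm_ring
    _ = (Ring.inverse (star L) * star L) * (L * Ring.inverse L) := by
        rw [h1]; noncomm_ring
    _ = 1 := by rw [Ring.mul_inverse_cancel L hL, Ring.inverse_mul_cancel _ hL', mul_one]

/-- The Möbius transform `(W + z̄)(1 + z W)⁻¹`. -/
noncomputable def mobius (z : ℂ) (W : A) : A := (W + conj z • (1 : A)) * Ring.inverse (1 + z • W)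

theorem star_mobius_mul_self {z : ℂ} {W : A} (hW : star W * W = 1) (ha : IsUnit (1 + z • W)) :
    star (mobius z W) * mobius z W = 1 := by
  have h1 : star (W + conj z • (1 : A)) * (W + conj z • (1 : A))
      = star (1 + z • W) * (1 + z • W) := by
    simp only [star_add, star_one, star_smul_eq_conj_smul, mul_add, add_mul, mul_one,
      one_mul, smul_mul_assoc, mul_smul_comm, hW, conj_conj]
    module
  rw [mobius, star_mul, ← Ring.inverse_star]
  set a := 1 + z • W
  have ha' : IsUnit (star a) := ha.star
  calc _ = Ring.inverse (star a) * (star (W + conj z • (1 : A)) * (W + conj z • (1 : A)))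
        * Ring.inverse a := by noncomm_ring
    _ = (Ring.inverse (star a) * star a) * (a * Ring.inverse a) := by rw [h1]; noncomm_ring
    _ = 1 := by rw [Ring.mul_inverse_cancel a ha, Ring.inverse_mul_cancel _ ha', mul_one]

theorem one_sub_smul_mobius_mul {z ζ : ℂ} {W : A} (ha : IsUnit (1 + z • W)) :
    (1 - ζ • mobius z W) * (1 + z • W) = (1 - ζ * conj z) • (1 : A) - (ζ - z) • W := by
  rw [sub_mul, smul_mul_assoc, mobius, mul_assoc, Ring.inverse_mul_cancel _ ha]
  simp only [mul_one, one_mul]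
  module

/-- The denominator of the fractional linear expression recovering `W` from the resolvent
`T = (1 - ζ (W + z̄)(1 + z W)⁻¹)⁻¹`. -/
noncomputable def resolventDen (z ζ : ℂ) (T : A) : A := (ζ - z) • T + z • (1 : A)

/-- The numerator of the fractional linear expression recovering `W` from the resolvent
`T = (1 - ζ (W + z̄)(1 + z W)⁻¹)⁻¹`. -/
noncomputable def resolventNum (z ζ : ℂ) (T : A) : A := (1 - ζ * conj z) • T - 1

/-- The operator `W` with `T = (1 - ζ (W + z̄)(1 + z W)⁻¹)⁻¹`. -/
noncomputable def ofResolvent (z ζ : ℂ) (T : A) : A := resolventNum z ζ T * Ring.inverse (resolventDen z ζ T)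

theorem one_sub_conj_mul_self_ne_zero {z : ℂ} (hz : ‖z‖ < 1) : 1 - conj z * z ≠ 0 := by
  rw [conj_mul', sub_ne_zero]
  intro h
  have h' : (1 : ℝ) = ‖z‖ ^ 2 := by exact_mod_cast h
  nlinarith [norm_nonneg z]

/-- With B = (1 - ζz̄) - (ζ - z)W one has TB = 1 + zW. Eliminating, the denominator times B is the
scalar ζ(1 - |z|²) and the numerator times B is that scalar times W. The scalar vanishes at ζ = 0,
where W cannot be recovered. -/
theorem resolventDen_and_ofResolvent {z ζ : ℂ} {W T : A} (hz : ‖z‖ < 1) (hζ : ζ ≠ 0)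
    (ha : IsUnit (1 + z • W)) (hr : (1 - ζ • mobius z W) * T = 1)
    (hl : T * (1 - ζ • mobius z W) = 1) :
    IsUnit (resolventDen z ζ T) ∧ ofResolvent z ζ T = W := by
  have hκ : ζ * (1 - conj z * z) ≠ 0 := mul_ne_zero hζ (one_sub_conj_mul_self_ne_zero hz)
  set B := (1 - ζ * conj z) • (1 : A) - (ζ - z) • W with hB
  have hBu : IsUnit B := by
    rw [hB, ← one_sub_smul_mobius_mul ha]
    exact IsUnit.mul ⟨⟨_, T, hr, hl⟩, rfl⟩ ha
  have hTB : T * B = 1 + z • W := by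
    rw [hB, ← one_sub_smul_mobius_mul ha, ← mul_assoc, hl, one_mul]
  have hDB : resolventDen z ζ T * B = (ζ * (1 - conj z * z)) • (1 : A) := by
    rw [resolventDen, add_mul, smul_mul_assoc, hTB, smul_mul_assoc, one_mul, hB]
    module
  have hNB : resolventNum z ζ T * B = (ζ * (1 - conj z * z)) • W := by
    rw [resolventNum, sub_mul, smul_mul_assoc, hTB, one_mul, hB]
    module
  have hD : IsUnit (resolventDen z ζ T) := by
    have h1 : IsUnit (resolventDen z ζ T * B) := by
      rw [hDB]; exact isUnit_smul_of_ne_zero hκ isUnit_one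
    obtain ⟨b, hb⟩ := hBu
    rw [← hb] at h1
    exact (Units.isUnit_mul_units _ b).mp h1
  refine ⟨hD, ?_⟩
  rw [ofResolvent, eq_comm, Ring.eq_mul_inverse_iff_mul_eq _ _ _ hD]
  have : W * resolventDen z ζ T * B = resolventNum z ζ T * B := by
    rw [mul_assoc, hDB, hNB, mul_smul_comm, mul_one]
  exact hBu.mul_right_cancel this

theorem isUnit_one_sub_smul_mobius_ofResolvent {z ζ : ℂ} {T : A} (hz : ‖z‖ < 1) (hζ : ζ ≠ 0)
    (hD : IsUnit (resolventDen z ζ T)) (ha : IsUnit (1 + z • ofResolvent z ζ T)) :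
    IsUnit (1 - ζ • mobius z (ofResolvent z ζ T)) := by
  have hκ : ζ * (1 - conj z * z) ≠ 0 := mul_ne_zero hζ (one_sub_conj_mul_self_ne_zero hz)
  have h1 : (1 - ζ • mobius z (ofResolvent z ζ T)) * (1 + z • ofResolvent z ζ T) *
      resolventDen z ζ T = (ζ * (1 - conj z * z)) • (1 : A) := by
    have h2 : ofResolvent z ζ T * resolventDen z ζ T = resolventNum z ζ T := by
      rw [ofResolvent, Ring.inverse_mul_cancel_right _ _ hD]
    rw [one_sub_smul_mobius_mul ha, sub_mul, smul_mul_assoc, one_mul, smul_mul_assoc, h2,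
      resolventDen, resolventNum]
    module
  have h3 : IsUnit ((1 - ζ • mobius z (ofResolvent z ζ T)) * (1 + z • ofResolvent z ζ T) *
      resolventDen z ζ T) := by
    rw [h1]; exact isUnit_smul_of_ne_zero hκ isUnit_one
  obtain ⟨d, hd⟩ := hD
  obtain ⟨a, ha⟩ := ha
  rw [← hd, ← ha, Units.isUnit_mul_units, Units.isUnit_mul_units] at h3
  exact h3

theorem isUnit_resolventDen {z ζ : ℂ} {T : A} (hz : ‖z‖ < 1) (hζ : ‖ζ‖ = 1)
    (hT : star T + T = 1) : IsUnit (resolventDen z ζ T) := by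
  have hne : ζ - z ≠ 0 := by
    rw [sub_ne_zero]; rintro rfl; exact hz.ne hζ
  -- With |ζ| = 1, real part 1/2 would force |z| = 1.
  have hw : (-z / (ζ - z)).re ≠ 1 / 2 := by
    intro h
    have hn : normSq (ζ - z) ≠ 0 := fun h => hne (normSq_eq_zero.mp h)
    rw [div_re, ← add_div, div_eq_div_iff hn two_ne_zero, normSq_apply] at h
    have h1 : ζ.re * ζ.re + ζ.im * ζ.im = 1 := by
      rw [← normSq_apply, normSq_eq_norm_sq, hζ, one_pow]
    have h2 : z.re * z.re + z.im * z.im < 1 := by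
      rw [← normSq_apply, normSq_eq_norm_sq]
      exact pow_lt_one₀ (norm_nonneg _) hz two_ne_zero
    simp only [neg_re, neg_im, sub_re, sub_im] at h
    nlinarith
  have heq : resolventDen z ζ T = (-(ζ - z)) • ((-z / (ζ - z)) • (1 : A) - T) := by
    rw [smul_sub, smul_smul, resolventDen]
    have : -(ζ - z) * (-z / (ζ - z)) = z := by field_simp
    rw [this]
    module
  rw [heq]
  exact isUnit_smul_of_ne_zero (neg_ne_zero.mpr hne) (isUnit_smul_one_sub_of_star_add_self hT hw)

theorem star_resolventNum_mul_self {z ζ : ℂ} {T : A} (hζ : ‖ζ‖ = 1) (hT : star T + T = 1) :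
    star (resolventNum z ζ T) * resolventNum z ζ T
      = star (resolventDen z ζ T) * resolventDen z ζ T := by
  have hζ' : conj ζ * ζ = 1 := by rw [conj_mul', hζ]; simp
  have hT' : star T = 1 - T := eq_sub_of_add_eq hT
  simp only [resolventNum, resolventDen, star_add, star_sub, star_one, star_smul_eq_conj_smul, hT',
    mul_add, add_mul, mul_sub, sub_mul, mul_one, one_mul, smul_mul_assoc,
    mul_smul_comm, conj_conj, smul_smul, map_sub, map_mul, map_one, smul_sub]
  match_scalars
  · linear_combination (z * conj z - 1) * hζ'
  · linear_combination (1 - z * conj z) * hζ'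
  · ring

/-- Normality upgrades the one-sided invertibility read off from invertibility of N*N to two-sided
invertibility of the numerator N. -/
theorem commute_star_resolventNum {z ζ : ℂ} {T : A} (hT : star T + T = 1) :
    Commute (star (resolventNum z ζ T)) (resolventNum z ζ T) := by
  have hT' : star T = 1 - T := eq_sub_of_add_eq hT
  have h1 : Commute (star T) T := by
    rw [hT']; exact (Commute.one_left T).sub_left (Commute.refl T)
  simp only [resolventNum, star_sub, star_smul, star_one]
  exact (((h1.smul_left _).smul_right _).sub_right (Commute.one_right _)).sub_left
    (Commute.one_left _)

theorem ofResolvent_mem_unitary {z ζ : ℂ} {T : A} (hz : ‖z‖ < 1) (hζ : ‖ζ‖ = 1)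
    (hT : star T + T = 1) : ofResolvent z ζ T ∈ unitary A := by
  have hD := isUnit_resolventDen hz hζ hT
  have hNN := star_resolventNum_mul_self (z := z) hζ hT
  have hN : IsUnit (resolventNum z ζ T) :=
    ((commute_star_resolventNum hT).isUnit_mul_iff.mp (hNN ▸ hD.star.mul hD)).2
  have hW : IsUnit (ofResolvent z ζ T) := hN.mul hD.ringInverse
  have hs : star (ofResolvent z ζ T) * ofResolvent z ζ T = 1 := by
    rw [ofResolvent, star_mul, ← Ring.inverse_star]
    calc _ = Ring.inverse (star (resolventDen z ζ T)) *
          (star (resolventNum z ζ T) * resolventNum z ζ T) *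
          Ring.inverse (resolventDen z ζ T) := by noncomm_ring
      _ = (Ring.inverse (star (resolventDen z ζ T)) * star (resolventDen z ζ T)) *
          (resolventDen z ζ T * Ring.inverse (resolventDen z ζ T)) := by
          rw [hNN]; noncomm_ring
      _ = 1 := by rw [Ring.mul_inverse_cancel _ hD, Ring.inverse_mul_cancel _ hD.star, mul_one]
  exact Unitary.mem_iff.mpr ⟨hs, hW.mul_right_cancel (by
    rw [mul_assoc, hs, mul_one, one_mul])⟩

theorem continuousAt_ofResolvent {z : ℂ} {T : ℂ → A} {ζ : ℂ} (hT : ContinuousAt T ζ)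
    (hD : IsUnit (resolventDen z ζ (T ζ))) : ContinuousAt (fun w => ofResolvent z w (T w)) ζ := by
  have h1 : ContinuousAt (fun w => resolventDen z w (T w)) ζ := by
    unfold resolventDen; fun_prop
  have h2 : ContinuousAt (fun w => resolventNum z w (T w)) ζ := by
    unfold resolventNum; fun_prop
  have h3 : ContinuousAt Ring.inverse (resolventDen z ζ (T ζ)) := by
    obtain ⟨d, hd⟩ := hD
    exact hd ▸ NormedRing.inverse_continuousAt d
  exact h2.mul (ContinuousAt.comp (f := fun w => resolventDen z w (T w)) h3 h1)

theorem isUnit_one_add_smul_of_norm_le_one {z : ℂ} {W : A} (hz : ‖z‖ < 1) (hW : ‖W‖ ≤ 1) :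
    IsUnit (1 + z • W) := by
  have h : ‖-(z • W)‖ < 1 := by
    rw [norm_neg, norm_smul]
    nlinarith [norm_nonneg z, norm_nonneg W]
  simpa using isUnit_one_sub_of_norm_lt_one h

end Algebra
-- The splitting of H along V_z and unitary extensions of V_z
section Extension

variable {H : Type u} [NormedAddCommGroup H] [InnerProductSpace ℂ H] {V : H →ₗ.[ℂ] H} {z : ℂ}

theorem norm_M_add_N_sq {w : ℂ} {m n : H} (hm : m ∈ M V w) (hn : n ∈ N V w) :
    ‖m + n‖ ^ 2 = ‖m‖ ^ 2 + ‖n‖ ^ 2 := by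
  rw [sq, sq, sq]
  exact norm_add_sq_eq_norm_sq_add_norm_sq_of_inner_eq_zero _ _
    (Submodule.inner_right_of_mem_orthogonal hm hn)

/-- Vx - z̄x = -z̄(x - z̄⁻¹Vx). Read backwards, the same identity shows that V_z maps onto M_{1/z̄}.
-/
theorem Vz_mem_M (hV : IsClosedIsometric V) (hz : ‖z‖ < 1) (h0 : z ≠ 0) (m : M V z) :
    Vz hV hz m ∈ M V (conj z)⁻¹ := by
  obtain ⟨x, rfl⟩ := (idSubInv hV hz).symm.surjective m
  have hc : conj z ≠ 0 := (map_ne_zero _).mpr h0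
  refine ⟨-conj z • x, ?_⟩
  have h : Vz hV hz ((idSubInv hV hz).symm x) = V x - conj z • (x : H) := by
    simp [Vz]
  rw [h, map_smul, idSub_apply, smul_sub, smul_smul, neg_mul, mul_inv_cancel₀ hc]
  module

theorem exists_Vz_eq (hV : IsClosedIsometric V) (hz : ‖z‖ < 1) (h0 : z ≠ 0) {y : H}
    (hy : y ∈ M V (conj z)⁻¹) : ∃ m, Vz hV hz m = y := by
  obtain ⟨x, rfl⟩ := hy
  have hc : conj z ≠ 0 := (map_ne_zero _).mpr h0
  refine ⟨(idSubInv hV hz).symm (-(conj z)⁻¹ • x), ?_⟩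
  have h : ∀ x, Vz hV hz ((idSubInv hV hz).symm x) = V x - conj z • (x : H) := by
    intro x; simp [Vz]
  rw [h, idSub_apply, LinearPMap.map_smul, Submodule.coe_smul, smul_smul, mul_neg, mul_inv_cancel₀ hc]
  module

variable [CompleteSpace H]

theorem Vplus_apply_M (hV : IsClosedIsometric V) (hz : ‖z‖ < 1)
    (C : N V z →L[ℂ] N V (conj z)⁻¹) (m : M V z) : Vplus hV hz C m = Vz hV hz m := by
  have := hasOrthogonalProjection_M hV hz
  have h : (N V z).orthogonalProjectionOnto (m : H) = 0 :=
    Submodule.orthogonalProjectionOnto_orthogonal_apply_eq_zero m.2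
  simp [Vplus, h]

theorem Vplus_apply_N (hV : IsClosedIsometric V) (hz : ‖z‖ < 1)
    (C : N V z →L[ℂ] N V (conj z)⁻¹) (n : N V z) : Vplus hV hz C n = C n := by
  have := hasOrthogonalProjection_M hV hz
  have h : (M V z).orthogonalProjectionOnto (n : H) = 0 :=
    Submodule.orthogonalProjectionOnto_eq_zero_iff.mpr n.2
  simp [Vplus, h]

theorem exists_eq_M_add_N (hV : IsClosedIsometric V) (hz : ‖z‖ < 1) (x : H) :
    ∃ (m : M V z) (n : N V z), x = m + n := by
  have := hasOrthogonalProjection_M hV hz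
  obtain ⟨m, hm, n, hn, h⟩ := (M V z).exists_add_mem_mem_orthogonal x
  exact ⟨⟨m, hm⟩, ⟨n, hn⟩, h⟩

theorem norm_Vplus_M_add_N_sq (hV : IsClosedIsometric V) (hz : ‖z‖ < 1) (h0 : z ≠ 0)
    (C : N V z →L[ℂ] N V (conj z)⁻¹) (m : M V z) (n : N V z) :
    ‖Vplus hV hz C (m + n)‖ ^ 2 = ‖m‖ ^ 2 + ‖C n‖ ^ 2 := by
  rw [map_add, Vplus_apply_M, Vplus_apply_N, norm_M_add_N_sq (Vz_mem_M hV hz h0 m) (C n).2,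
    (Vz hV hz).norm_map, Submodule.coe_norm (C n)]

theorem norm_Vplus_le_one (hV : IsClosedIsometric V) (hz : ‖z‖ < 1) (h0 : z ≠ 0)
    {C : N V z →L[ℂ] N V (conj z)⁻¹} (hC : ‖C‖ ≤ 1) : ‖Vplus hV hz C‖ ≤ 1 := by
  refine ContinuousLinearMap.opNorm_le_bound _ zero_le_one fun x => ?_
  obtain ⟨m, n, rfl⟩ := exists_eq_M_add_N hV hz x
  rw [one_mul, ← sq_le_sq₀ (norm_nonneg _) (norm_nonneg _), norm_Vplus_M_add_N_sq hV hz h0,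
    norm_M_add_N_sq m.2 n.2]
  have h : ‖C n‖ ≤ ‖n‖ := by simpa using C.le_of_opNorm_le hC n
  have := pow_le_pow_left₀ (norm_nonneg _) h 2
  simpa using this

theorem star_Vplus_mul_self (hV : IsClosedIsometric V) (hz : ‖z‖ < 1) (h0 : z ≠ 0)
    {C : N V z →L[ℂ] N V (conj z)⁻¹} (hC : ∀ x, ‖C x‖ = ‖x‖) :
    star (Vplus hV hz C) * Vplus hV hz C = 1 := by
  refine (ContinuousLinearMap.norm_map_iff_adjoint_comp_self _).mp fun x => ?_
  obtain ⟨m, n, rfl⟩ := exists_eq_M_add_N hV hz x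
  rw [← sq_eq_sq₀ (norm_nonneg _) (norm_nonneg _), norm_Vplus_M_add_N_sq hV hz h0,
    norm_M_add_N_sq m.2 n.2, hC]
  simp

/-- The compression of an operator in `H` to an operator from `N_z` to `N_{1/z̄}`. -/
noncomputable def compression (V : H →ₗ.[ℂ] H) (z : ℂ) (W : H →L[ℂ] H) :
    N V z →L[ℂ] N V (conj z)⁻¹ :=
  (N V (conj z)⁻¹).orthogonalProjectionOnto ∘L W ∘L (N V z).subtypeL

theorem continuous_compression : Continuous (compression V z) := by
  unfold compression
  fun_prop

theorem compression_Vplus (hV : IsClosedIsometric V) (hz : ‖z‖ < 1)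
    (C : N V z →L[ℂ] N V (conj z)⁻¹) : compression V z (Vplus hV hz C) = C := by
  ext n
  simp [compression, Vplus_apply_N]

theorem inner_eq_of_mem_unitary {W : H →L[ℂ] H} (hW : W ∈ unitary (H →L[ℂ] H)) (x y : H) :
    inner ℂ (W x) (W y) = inner ℂ x y :=
  (ContinuousLinearMap.inner_map_map_iff_adjoint_comp_self W).mpr
    (Unitary.star_mul_self_of_mem hW) x y

/-- W preserves inner products and carries M_z onto M_{1/z̄}, hence matches their orthogonal
complements. -/
theorem mem_N_of_mem_unitary (hV : IsClosedIsometric V) (hz : ‖z‖ < 1) (h0 : z ≠ 0)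
    {W : H →L[ℂ] H} (hW : W ∈ unitary (H →L[ℂ] H)) (hM : ∀ m : M V z, W m = Vz hV hz m) (x : H) :
    W x ∈ N V (conj z)⁻¹ ↔ x ∈ N V z := by
  simp only [N, Submodule.mem_orthogonal]
  constructor
  · intro h m hm
    rw [← inner_eq_of_mem_unitary hW, hM ⟨m, hm⟩]
    exact h _ (Vz_mem_M hV hz h0 _)
  · intro h y hy
    obtain ⟨m, rfl⟩ := exists_Vz_eq hV hz h0 hy
    rw [← hM, inner_eq_of_mem_unitary hW]
    exact h _ m.2

theorem compression_apply_of_mem_unitary (hV : IsClosedIsometric V) (hz : ‖z‖ < 1) (h0 : z ≠ 0)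
    {W : H →L[ℂ] H} (hW : W ∈ unitary (H →L[ℂ] H)) (hM : ∀ m : M V z, W m = Vz hV hz m)
    (n : N V z) : (compression V z W n : H) = W n := by
  have h := (mem_N_of_mem_unitary hV hz h0 hW hM (n : H)).mpr n.2
  exact congrArg Subtype.val
    ((N V (conj z)⁻¹).orthogonalProjectionOnto_mem_subspace_eq_self ⟨W n, h⟩)

theorem Vplus_compression_of_mem_unitary (hV : IsClosedIsometric V) (hz : ‖z‖ < 1) (h0 : z ≠ 0)
    {W : H →L[ℂ] H} (hW : W ∈ unitary (H →L[ℂ] H)) (hM : ∀ m : M V z, W m = Vz hV hz m) :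
    Vplus hV hz (compression V z W) = W := by
  ext x
  obtain ⟨m, n, rfl⟩ := exists_eq_M_add_N hV hz x
  rw [map_add, map_add, Vplus_apply_M, Vplus_apply_N,
    compression_apply_of_mem_unitary hV hz h0 hW hM, hM]

theorem norm_compression_apply_of_mem_unitary (hV : IsClosedIsometric V) (hz : ‖z‖ < 1)
    (h0 : z ≠ 0) {W : H →L[ℂ] H} (hW : W ∈ unitary (H →L[ℂ] H))
    (hM : ∀ m : M V z, W m = Vz hV hz m) (n : N V z) : ‖compression V z W n‖ = ‖n‖ := by
  rw [← Submodule.norm_coe, compression_apply_of_mem_unitary hV hz h0 hW hM]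
  exact (ContinuousLinearMap.norm_map_iff_adjoint_comp_self W).mpr
    (Unitary.star_mul_self_of_mem hW) n

theorem compression_surjective_of_mem_unitary (hV : IsClosedIsometric V) (hz : ‖z‖ < 1)
    (h0 : z ≠ 0) {W : H →L[ℂ] H} (hW : W ∈ unitary (H →L[ℂ] H))
    (hM : ∀ m : M V z, W m = Vz hV hz m) : Function.Surjective (compression V z W) := by
  intro y
  have hWs : W (star W (y : H)) = y :=
    DFunLike.congr_fun (Unitary.mul_star_self_of_mem hW) (y : H)
  have hx : star W (y : H) ∈ N V z :=
    (mem_N_of_mem_unitary hV hz h0 hW hM _).mp (hWs.symm ▸ y.2)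
  refine ⟨⟨_, hx⟩, Subtype.ext ?_⟩
  rw [compression_apply_of_mem_unitary hV hz h0 hW hM, hWs]

end Extension

/-! ### Analyticity and reflection symmetry of generalized resolvents -/

section Resolvent

variable {H : Type u} [NormedAddCommGroup H] [InnerProductSpace ℂ H] [CompleteSpace H]
  {V : H →ₗ.[ℂ] H} {R : ℂ → (H →L[ℂ] H)}

theorem IsGeneralizedResolvent.differentiableAt (hR : IsGeneralizedResolvent.{u, v} V R) {ζ : ℂ}
    (hζ : ‖ζ‖ ≠ 1) : DifferentiableAt ℂ R ζ := by
  obtain ⟨K, _, _, _, ι, U, hU, -, hRU⟩ := hR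
  have h1 : DifferentiableAt ℂ (fun w : ℂ => Ring.inverse (1 - w • U)) ζ :=
    DifferentiableAt.comp (f := fun w : ℂ => 1 - w • U) ζ
      (differentiableAt_inverse (isUnit_one_sub_smul_of_mem_unitary hU hζ)) (by fun_prop)
  have h2 : DifferentiableAt ℂ (fun w : ℂ =>
      (ContinuousLinearMap.adjoint ι.toContinuousLinearMap) ∘L
        (Ring.inverse (1 - w • U)) ∘L ι.toContinuousLinearMap) ζ :=
    (differentiableAt_const _).clm_comp (h1.clm_comp (differentiableAt_const _))
  refine h2.congr_of_eventuallyEq ?_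
  filter_upwards [(isOpen_ne.preimage continuous_norm).mem_nhds hζ] with w hw using hRU w hw

theorem IsGeneralizedResolvent.star_add (hR : IsGeneralizedResolvent.{u, v} V R) {ζ : ℂ}
    (h0 : ζ ≠ 0) (hζ : ‖ζ‖ ≠ 1) : star (R ζ) + R (conj ζ)⁻¹ = 1 := by
  obtain ⟨K, _, _, _, ι, U, hU, -, hRU⟩ := hR
  have h := star_inverse_one_sub_smul_add hU h0 hζ
  rw [hRU ζ hζ, hRU (conj ζ)⁻¹ (by rwa [norm_inv, RCLike.norm_conj, Ne, inv_eq_one])]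
  rw [ContinuousLinearMap.star_eq_adjoint, ContinuousLinearMap.adjoint_comp,
    ContinuousLinearMap.adjoint_comp, ContinuousLinearMap.adjoint_adjoint,
    ContinuousLinearMap.comp_assoc, ← ContinuousLinearMap.comp_add,
    ← ContinuousLinearMap.add_comp, ← ContinuousLinearMap.star_eq_adjoint, h]
  -- What remains is that the embedding is isometric: ι*ι = 1.
  ext x
  refine ext_inner_right ℂ fun y => ?_
  simp [ContinuousLinearMap.adjoint_inner_left]

end Resolvent
-- Arcs and reflection in the unit circle
section OpenArc

variable {Δ : Set ℂ}

theorem IsOpenArc.norm_eq_one (hΔ : IsOpenArc Δ) {ζ : ℂ} (hζ : ζ ∈ Δ) : ‖ζ‖ = 1 := by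
  obtain ⟨a, b, -, rfl⟩ := hΔ
  obtain ⟨θ, -, rfl⟩ := hζ
  exact norm_exp_ofReal_mul_I θ

/-- Δ is relatively open in the circle: near exp(iθ), a point w of the circle has the angle θ +
arg(w / exp(iθ)), which is close to θ. -/
theorem IsOpenArc.eventually_mem (hΔ : IsOpenArc Δ) {ζ : ℂ} (hζ : ζ ∈ Δ) :
    ∀ᶠ w in 𝓝 ζ, ‖w‖ = 1 → w ∈ Δ := by
  obtain ⟨a, b, -, rfl⟩ := hΔ
  obtain ⟨θ, hθ, rfl⟩ := hζ
  have hne : exp (θ * I) ≠ 0 := exp_ne_zero _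
  have hc : ContinuousAt (fun w : ℂ => θ + arg (w / exp (θ * I))) (exp (θ * I)) := by
    refine continuousAt_const.add (ContinuousAt.comp (continuousAt_arg ?_) ?_)
    · simp [hne]
    · exact continuousAt_id.div continuousAt_const hne
  have hmem : ∀ᶠ w in 𝓝 (exp (θ * I)), θ + arg (w / exp (θ * I)) ∈ Ioo a b := by
    refine hc.eventually (isOpen_Ioo.mem_nhds ?_)
    simpa [hne] using hθ
  filter_upwards [hmem] with w hw hw1
  refine ⟨_, hw, ?_⟩
  have h := norm_mul_exp_arg_mul_I (w / exp (θ * I))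
  rw [norm_div, hw1, norm_exp_ofReal_mul_I, div_one, ofReal_one, one_mul] at h
  simp only [ofReal_add, add_mul, exp_add, h]
  exact mul_div_cancel₀ w hne

theorem nhdsWithin_ball_neBot {ζ : ℂ} (hζ : ‖ζ‖ = 1) : (𝓝[ball (0 : ℂ) 1] ζ).NeBot := by
  rw [← mem_closure_iff_nhdsWithin_neBot, closure_ball _ one_ne_zero]
  simp [hζ]

theorem inv_conj_eq_self {ζ : ℂ} (hζ : ‖ζ‖ = 1) : (conj ζ)⁻¹ = ζ := by
  have h : conj ζ * ζ = 1 := by rw [conj_mul', hζ]; simp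
  exact inv_eq_of_mul_eq_one_right h

theorem continuousAt_inv_conj {ζ : ℂ} (h0 : ζ ≠ 0) :
    ContinuousAt (fun w : ℂ => (conj w)⁻¹) ζ :=
  continuous_conj.continuousAt.inv₀ ((map_ne_zero _).mpr h0)

end OpenArc

/-! ### The two implications -/

section Continuation

variable {H : Type u} [NormedAddCommGroup H] [InnerProductSpace ℂ H] [CompleteSpace H]
  {V : H →ₗ.[ℂ] H} {R : ℂ → (H →L[ℂ] H)} {z : ℂ} {Δ : Set ℂ}
  {C : ℂ → (N V z →L[ℂ] N V (conj z)⁻¹)}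

theorem continuous_Vplus (hV : IsClosedIsometric V) (hz : ‖z‖ < 1) :
    Continuous (Vplus hV hz) := by
  unfold Vplus
  fun_prop

theorem IninCorresponds.ofResolvent_eq_Vplus (hV : IsClosedIsometric V) (hz : ‖z‖ < 1)
    (h0 : z ≠ 0) (hC : IninCorresponds hV hz R C) {ζ : ℂ} (hζ : ζ ∈ ball (0 : ℂ) 1)
    (hζ0 : ζ ≠ 0) : ofResolvent z ζ (R ζ) = Vplus hV hz (C ζ) :=
  (resolventDen_and_ofResolvent hz hζ0 (isUnit_one_add_smul_of_norm_le_one hz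
    (norm_Vplus_le_one hV hz h0 (hC.schur.contraction ζ hζ))) (hC.right_inv ζ hζ)
    (hC.left_inv ζ hζ)).2

theorem star_add_self_of_continuousAt (hR : IsGeneralizedResolvent.{u, v} V R)
    {T : ℂ → (H →L[ℂ] H)} (hTR : ∀ w : ℂ, ‖w‖ ≠ 1 → T w = R w) {ζ : ℂ} (hζ : ‖ζ‖ = 1)
    (hT : ContinuousAt T ζ) : star (T ζ) + T ζ = 1 := by
  have hζ0 : ζ ≠ 0 := norm_ne_zero_iff.mp (by simp [hζ])
  have := nhdsWithin_ball_neBot hζ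
  -- As w tends to ζ from the disc, 1/w̄ tends to ζ from outside, so the identity off the circle
  -- passes to the limit.
  have h1 : ContinuousAt (fun w => star (T w) + T (conj w)⁻¹) ζ := by
    refine hT.star.add (ContinuousAt.comp (f := fun w : ℂ => (conj w)⁻¹) ?_
      (continuousAt_inv_conj hζ0))
    simpa only [inv_conj_eq_self hζ] using hT
  have h2 := h1.continuousWithinAt (s := ball 0 1)
  simp only [ContinuousWithinAt, inv_conj_eq_self hζ] at h2
  refine tendsto_nhds_unique h2 (tendsto_const_nhds.congr' ?_)
  filter_upwards [self_mem_nhdsWithin, nhdsWithin_le_nhds (isOpen_ne.mem_nhds hζ0)] with w hw hw0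
  have hw1 : ‖w‖ ≠ 1 := (mem_ball_zero_iff.mp hw).ne
  rw [hTR w hw1, hTR _ (by rwa [norm_inv, RCLike.norm_conj, Ne, inv_eq_one]), hR.star_add hw0 hw1]

theorem ofResolvent_apply_M (hV : IsClosedIsometric V) (hz : ‖z‖ < 1) (h0 : z ≠ 0)
    (hC : IninCorresponds hV hz R C) {T : ℂ → (H →L[ℂ] H)}
    (hTR : ∀ w : ℂ, ‖w‖ ≠ 1 → T w = R w) {ζ : ℂ} (hζ : ‖ζ‖ = 1)
    (hW : ContinuousAt (fun w => ofResolvent z w (T w)) ζ) (m : M V z) :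
    ofResolvent z ζ (T ζ) m = Vz hV hz m := by
  have hζ0 : ζ ≠ 0 := norm_ne_zero_iff.mp (by simp [hζ])
  have := nhdsWithin_ball_neBot hζ
  have h1 : ContinuousAt (fun w => ofResolvent z w (T w) (m : H)) ζ :=
    hW.clm_apply continuousAt_const
  refine tendsto_nhds_unique (h1.continuousWithinAt (s := ball 0 1))
    (tendsto_const_nhds.congr' ?_)
  filter_upwards [self_mem_nhdsWithin, nhdsWithin_le_nhds (isOpen_ne.mem_nhds hζ0)] with w hw hw0
  rw [hTR w (mem_ball_zero_iff.mp hw).ne, hC.ofResolvent_eq_Vplus hV hz h0 hw hw0,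
    Vplus_apply_M]

theorem exists_extension_of_hasAnalyticContinuation (hV : IsClosedIsometric V) (hz : ‖z‖ < 1)
    (h0 : z ≠ 0) (hR : IsGeneralizedResolvent.{u, v} V R) (hC : IninCorresponds hV hz R C)
    (hΔ : IsOpenArc Δ) (h : HasAnalyticContinuation R Δ) :
    ∃ C' : ℂ → (N V z →L[ℂ] N V (conj z)⁻¹),
      (∀ ζ ∈ ball (0 : ℂ) 1, C' ζ = C ζ) ∧
      ContinuousOn C' (ball (0 : ℂ) 1 ∪ Δ) ∧
      (∀ ζ ∈ Δ, (∀ x, ‖C' ζ x‖ = ‖x‖) ∧ Function.Surjective (C' ζ)) ∧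
      (∀ ζ ∈ Δ, Function.Bijective (1 - ζ • VC hV hz (C' ζ) : H →L[ℂ] H)) := by
  obtain ⟨T, hT, hTR⟩ := h
  have hTc : ∀ ζ ∈ Δ, ContinuousAt T ζ := fun ζ hζ => (hT ζ (Or.inr hζ)).continuousAt
  have hTs : ∀ ζ ∈ Δ, star (T ζ) + T ζ = 1 := fun ζ hζ =>
    star_add_self_of_continuousAt hR hTR (hΔ.norm_eq_one hζ) (hTc ζ hζ)
  have hD : ∀ ζ ∈ Δ, IsUnit (resolventDen z ζ (T ζ)) := fun ζ hζ =>
    isUnit_resolventDen hz (hΔ.norm_eq_one hζ) (hTs ζ hζ)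
  have hWc : ∀ ζ ∈ Δ, ContinuousAt (fun w => ofResolvent z w (T w)) ζ := fun ζ hζ =>
    continuousAt_ofResolvent (hTc ζ hζ) (hD ζ hζ)
  have hWu : ∀ ζ ∈ Δ, ofResolvent z ζ (T ζ) ∈ unitary (H →L[ℂ] H) := fun ζ hζ =>
    ofResolvent_mem_unitary hz (hΔ.norm_eq_one hζ) (hTs ζ hζ)
  have hWM : ∀ ζ ∈ Δ, ∀ m : M V z, ofResolvent z ζ (T ζ) m = Vz hV hz m := fun ζ hζ =>
    ofResolvent_apply_M hV hz h0 hC hTR (hΔ.norm_eq_one hζ) (hWc ζ hζ)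
  classical
  let C' : ℂ → (N V z →L[ℂ] N V (conj z)⁻¹) := fun ζ =>
    if ζ ∈ ball (0 : ℂ) 1 then C ζ else compression V z (ofResolvent z ζ (T ζ))
  have hCin : ∀ ζ ∈ ball (0 : ℂ) 1, C' ζ = C ζ := fun ζ hζ => if_pos hζ
  have hCout : ∀ ζ ∈ Δ, C' ζ = compression V z (ofResolvent z ζ (T ζ)) := fun ζ hζ =>
    if_neg (by simp [hΔ.norm_eq_one hζ])
  refine ⟨C', hCin, ?_, fun ζ hζ => ?_, fun ζ hζ => ?_⟩
  · rintro ζ (hζ | hζ)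
    · refine ((hC.schur.analytic ζ hζ).continuousAt.congr ?_).continuousWithinAt
      filter_upwards [isOpen_ball.mem_nhds hζ] with w hw using (hCin w hw).symm
    · have hζ0 : ζ ≠ 0 := norm_ne_zero_iff.mp (by simp [hΔ.norm_eq_one hζ])
      have h1 : ContinuousAt (fun w => compression V z (ofResolvent z w (T w))) ζ :=
        ContinuousAt.comp (f := fun w => ofResolvent z w (T w))
          continuous_compression.continuousAt (hWc ζ hζ)
      refine h1.continuousWithinAt.congr_of_eventuallyEq ?_ (hCout ζ hζ)
      -- Near ζ, on both the disc and Δ, the extension is the single expression obtained by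
      -- compressing `ofResolvent`. The point 0, where that formula degenerates, is excluded.
      filter_upwards [nhdsWithin_le_nhds (isOpen_ne.mem_nhds hζ0), self_mem_nhdsWithin]
        with w hw0 hw
      rcases hw with hw | hw
      · rw [hCin w hw, hTR w (mem_ball_zero_iff.mp hw).ne,
          hC.ofResolvent_eq_Vplus hV hz h0 hw hw0, compression_Vplus]
      · exact hCout w hw
  · rw [hCout ζ hζ]
    exact ⟨norm_compression_apply_of_mem_unitary hV hz h0 (hWu ζ hζ) (hWM ζ hζ),
      compression_surjective_of_mem_unitary hV hz h0 (hWu ζ hζ) (hWM ζ hζ)⟩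
  · have hζ0 : ζ ≠ 0 := norm_ne_zero_iff.mp (by simp [hΔ.norm_eq_one hζ])
    have hVC : VC hV hz (C' ζ) = mobius z (ofResolvent z ζ (T ζ)) := by
      rw [hCout ζ hζ, VC, Vplus_compression_of_mem_unitary hV hz h0 (hWu ζ hζ) (hWM ζ hζ)]
      rfl
    rw [hVC, ← ContinuousLinearMap.isUnit_iff_bijective]
    refine isUnit_one_sub_smul_mobius_ofResolvent hz hζ0 (hD ζ hζ)
      (isUnit_one_add_smul_of_norm_le_one hz ?_)
    refine ContinuousLinearMap.opNorm_le_bound _ zero_le_one fun x => ?_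
    rw [one_mul]
    exact ((ContinuousLinearMap.norm_map_iff_adjoint_comp_self _).mpr
      (Unitary.star_mul_self_of_mem (hWu ζ hζ)) x).le

theorem continuousOn_inverse_one_sub_smul_VC (hV : IsClosedIsometric V) (hz : ‖z‖ < 1)
    (h0 : z ≠ 0) {S : Set ℂ} (hc : ContinuousOn C S) (hn : ∀ ζ ∈ S, ‖C ζ‖ ≤ 1)
    (hu : ∀ ζ ∈ S, IsUnit (1 - ζ • VC hV hz (C ζ))) :
    ContinuousOn (fun ζ => Ring.inverse (1 - ζ • VC hV hz (C ζ))) S := by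
  have hinv : ∀ {f : ℂ → (H →L[ℂ] H)} {ζ : ℂ}, IsUnit (f ζ) → ContinuousWithinAt f S ζ →
      ContinuousWithinAt (fun w => Ring.inverse (f w)) S ζ := by
    intro f ζ ⟨u, hu⟩ hf
    have h : ContinuousAt Ring.inverse (f ζ) := hu ▸ NormedRing.inverse_continuousAt u
    exact h.comp_continuousWithinAt hf
  intro ζ hζ
  have hW : ContinuousWithinAt (fun w => Vplus hV hz (C w)) S ζ :=
    (continuous_Vplus hV hz).continuousAt.comp_continuousWithinAt (hc ζ hζ)
  have hA : ContinuousWithinAt (fun w => VC hV hz (C w)) S ζ := by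
    refine (hW.add continuousWithinAt_const).mul (hinv ?_ ?_)
    · exact isUnit_one_add_smul_of_norm_le_one hz (norm_Vplus_le_one hV hz h0 (hn ζ hζ))
    · exact continuousWithinAt_const.add (hW.const_smul z)
  exact hinv (hu ζ hζ) (continuousWithinAt_const.sub (continuousWithinAt_id.smul hA))

theorem hasAnalyticContinuation_of_extension (hV : IsClosedIsometric V) (hz : ‖z‖ < 1)
    (h0 : z ≠ 0) (hR : IsGeneralizedResolvent.{u, v} V R) (hC : IninCorresponds hV hz R C)
    (hΔ : IsOpenArc Δ) {C' : ℂ → (N V z →L[ℂ] N V (conj z)⁻¹)}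
    (hCC' : ∀ ζ ∈ ball (0 : ℂ) 1, C' ζ = C ζ) (hc : ContinuousOn C' (ball (0 : ℂ) 1 ∪ Δ))
    (hiso : ∀ ζ ∈ Δ, ∀ x, ‖C' ζ x‖ = ‖x‖)
    (hbij : ∀ ζ ∈ Δ, Function.Bijective (1 - ζ • VC hV hz (C' ζ) : H →L[ℂ] H)) :
    HasAnalyticContinuation R Δ := by
  classical
  let G : ℂ → (H →L[ℂ] H) := fun ζ => Ring.inverse (1 - ζ • VC hV hz (C' ζ))
  have hnorm : ∀ ζ ∈ ball (0 : ℂ) 1 ∪ Δ, ‖C' ζ‖ ≤ 1 := by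
    rintro ζ (hζ | hζ)
    · exact hCC' ζ hζ ▸ hC.schur.contraction ζ hζ
    · exact ContinuousLinearMap.opNorm_le_bound _ zero_le_one fun x => by
        rw [hiso ζ hζ, one_mul]
  have hunit : ∀ ζ ∈ ball (0 : ℂ) 1 ∪ Δ, IsUnit (1 - ζ • VC hV hz (C' ζ)) := by
    rintro ζ (hζ | hζ)
    · rw [hCC' ζ hζ]
      exact ⟨⟨_, R ζ, hC.right_inv ζ hζ, hC.left_inv ζ hζ⟩, rfl⟩
    · exact ContinuousLinearMap.isUnit_iff_bijective.mpr (hbij ζ hζ)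
  have hGc : ContinuousOn G (ball (0 : ℂ) 1 ∪ Δ) :=
    continuousOn_inverse_one_sub_smul_VC hV hz h0 hc hnorm hunit
  have hGR : ∀ ζ ∈ ball (0 : ℂ) 1, G ζ = R ζ := by
    intro ζ hζ
    have h1 : Ring.inverse (1 - ζ • VC hV hz (C ζ)) = R ζ :=
      Ring.inverse_unit ⟨_, R ζ, hC.right_inv ζ hζ, hC.left_inv ζ hζ⟩
    rw [← h1, ← hCC' ζ hζ]
  have hGs : ∀ ζ ∈ Δ, star (G ζ) + G ζ = 1 := fun ζ hζ =>
    star_inverse_add_inverse_one_sub_smul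
      (star_mobius_mul_self (star_Vplus_mul_self hV hz h0 (hiso ζ hζ))
        (isUnit_one_add_smul_of_norm_le_one hz
          (norm_Vplus_le_one hV hz h0 (hnorm ζ (Or.inr hζ)))))
      (hΔ.norm_eq_one hζ) (hunit ζ (Or.inr hζ))
  -- On the circle off Δ the value is arbitrary, since analyticity is not claimed there.
  let T : ℂ → (H →L[ℂ] H) := fun ζ => if ‖ζ‖ = 1 then G ζ else R ζ
  have hTR : ∀ ζ, ‖ζ‖ ≠ 1 → T ζ = R ζ := fun ζ hζ => if_neg hζ
  have hTΔ : ∀ ζ ∈ Δ, T ζ = G ζ := fun ζ hζ => if_pos (hΔ.norm_eq_one hζ)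
  have hTd : ∀ ζ, ‖ζ‖ ≠ 1 → DifferentiableAt ℂ T ζ := by
    intro ζ hζ
    refine (hR.differentiableAt hζ).congr_of_eventuallyEq ?_
    filter_upwards [(isOpen_ne.preimage continuous_norm).mem_nhds hζ] with w hw using hTR w hw
  have hTin : ∀ ζ ∈ ball (0 : ℂ) 1 ∪ Δ, T ζ = G ζ := by
    rintro ζ (hζ | hζ)
    · rw [hTR ζ (mem_ball_zero_iff.mp hζ).ne, hGR ζ hζ]
    · exact hTΔ ζ hζ
  have hmaps : MapsTo (fun w : ℂ => (conj w)⁻¹) ({w | 1 < ‖w‖} ∪ Δ) (ball (0 : ℂ) 1 ∪ Δ) := by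
    rintro w (hw | hw)
    · left
      rw [mem_ball_zero_iff, norm_inv, RCLike.norm_conj]
      exact inv_lt_one_of_one_lt₀ hw
    · right
      simpa only [inv_conj_eq_self (hΔ.norm_eq_one hw)] using hw
  -- One reflection formula covers the exterior and Δ together, so continuity of G on 𝔻 ∪ Δ gives
  -- continuity of T from outside.
  have hTout : ∀ ζ ∈ {w : ℂ | 1 < ‖w‖} ∪ Δ, T ζ = 1 - star (G (conj ζ)⁻¹) := by
    rintro ζ (hζ | hζ)
    · have hζ1 : ‖ζ‖ ≠ 1 := (show 1 < ‖ζ‖ from hζ).ne'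
      have hζ0 : ζ ≠ 0 := norm_ne_zero_iff.mp (zero_lt_one.trans hζ).ne'
      have hin : (conj ζ)⁻¹ ∈ ball (0 : ℂ) 1 := by
        rw [mem_ball_zero_iff, norm_inv, RCLike.norm_conj]
        exact inv_lt_one_of_one_lt₀ hζ
      have h1 := hR.star_add (inv_ne_zero ((map_ne_zero _).mpr hζ0)) (mem_ball_zero_iff.mp hin).ne
      rw [map_inv₀, conj_conj, inv_inv] at h1
      rw [hTR ζ hζ1, hGR _ hin]
      exact eq_sub_of_add_eq' h1
    · rw [hTΔ ζ hζ, inv_conj_eq_self (hΔ.norm_eq_one hζ)]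
      exact eq_sub_of_add_eq' (hGs ζ hζ)
  have hTc : ∀ ζ ∈ Δ, ContinuousAt T ζ := by
    intro ζ hζ
    have hζ0 : ζ ≠ 0 := norm_ne_zero_iff.mp (by simp [hΔ.norm_eq_one hζ])
    have h1 : ContinuousWithinAt T (ball (0 : ℂ) 1 ∪ Δ) ζ :=
      (hGc ζ (Or.inr hζ)).congr hTin (hTΔ ζ hζ)
    have h2 : ContinuousWithinAt T ({w | 1 < ‖w‖} ∪ Δ) ζ := by
      refine ContinuousWithinAt.congr ?_ hTout (hTout ζ (Or.inr hζ))
      refine continuousWithinAt_const.sub (ContinuousWithinAt.star ?_)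
      exact ContinuousWithinAt.comp (f := fun w : ℂ => (conj w)⁻¹) (hGc _ (hmaps (Or.inr hζ)))
        (continuousAt_inv_conj hζ0).continuousWithinAt hmaps
    refine (h1.union h2).continuousAt ?_
    filter_upwards [hΔ.eventually_mem hζ] with w hw
    rcases lt_trichotomy ‖w‖ 1 with h | h | h
    · exact Or.inl (Or.inl (mem_ball_zero_iff.mpr h))
    · exact Or.inl (Or.inr (hw h))
    · exact Or.inr (Or.inl h)
  refine ⟨T, ?_, hTR⟩
  have hopen : ∀ ζ : ℂ, ‖ζ‖ ≠ 1 → AnalyticAt ℂ T ζ := fun ζ hζ =>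
    (DifferentiableOn.analyticAt (s := {w : ℂ | ‖w‖ ≠ 1})
      (fun w hw => (hTd w hw).differentiableWithinAt)
      ((isOpen_ne.preimage continuous_norm).mem_nhds hζ))
  rintro ζ ((hζ | hζ) | hζ)
  · exact hopen ζ (show ‖ζ‖ < 1 from hζ).ne
  · exact hopen ζ (show 1 < ‖ζ‖ from hζ).ne'
  · obtain ⟨a, b, -, rfl⟩ := hΔ
    obtain ⟨θ, hθ, rfl⟩ := hζ
    exact analyticAt_exp_of_continuousOn_of_differentiableAt hθ
      (fun t ht => hTc _ ⟨t, ht, rfl⟩) hTd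

end Continuation

end GenRes

theorem theorem3p2 {H : Type u} [NormedAddCommGroup H] [InnerProductSpace ℂ H]
    [CompleteSpace H]
    (V : H →ₗ.[ℂ] H) (hV : GenRes.IsClosedIsometric V)
    (z₀ : ℂ) (hz₀ : ‖z₀‖ < 1) (hz₀' : z₀ ≠ 0)
    (R : ℂ → (H →L[ℂ] H)) (hR : GenRes.IsGeneralizedResolvent.{u, v} V R)
    (C : ℂ → (GenRes.N V z₀ →L[ℂ] GenRes.N V (conj z₀)⁻¹))
    (hC : GenRes.IninCorresponds hV hz₀ R C)
    (Δ : Set ℂ) (hΔ : GenRes.IsOpenArc Δ) :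
    GenRes.HasAnalyticContinuation R Δ ↔
      ∃ C' : ℂ → (GenRes.N V z₀ →L[ℂ] GenRes.N V (conj z₀)⁻¹),
        (∀ ζ ∈ ball (0 : ℂ) 1, C' ζ = C ζ) ∧
        ContinuousOn C' (ball (0 : ℂ) 1 ∪ Δ) ∧
        (∀ ζ ∈ Δ, (∀ x, ‖C' ζ x‖ = ‖x‖) ∧ Function.Surjective (C' ζ)) ∧
        (∀ ζ ∈ Δ, Function.Bijective (1 - ζ • GenRes.VC hV hz₀ (C' ζ) : H →L[ℂ] H)) := by
  constructor
  · exact GenRes.exists_extension_of_hasAnalyticContinuation hV hz₀ hz₀' hR hC hΔ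
  · rintro ⟨C', hCC', hc, hiso, hbij⟩
    exact GenRes.hasAnalyticContinuation_of_extension hV hz₀ hz₀' hR hC hΔ hCC' hc
      (fun ζ hζ => (hiso ζ hζ).1) hbij
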